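/- Let $O$ be an observable, i.e. a Hermitian operator on a finite-dimensional Hilbert space, with operator norm $\|O\|$. For $s=1,2,\dots$ let $\alpha_s\in\{\pm1\}$, $D_s\in\{0,1\}$ and $O_s\in[-\|O\|,\|O\|]$ be random variables on one probability space such that $O_s=0$ whenever $D_s=0$, and put $X_s=\alpha_sO_s$, $Y_s=\alpha_sD_s$. Assume that the pairs $(X_s,Y_s)$ are i.i.d. with $\mu_Y=\mathbb E[Y_s]\neq0$, and set $\mu_X=\mathbb E[X_s]$, $\mu=\mu_X/\mu_Y$ and $$\sigma_\mu^2=\frac{\mathrm{Var}(X_s-\mu Y_s)}{\mu_Y^2},\qquad \sigma_\mu\ge 0 .$$ Let $\hat\mu=\hat\mu_N=\sum_{s=1}^N X_s\big/\sum_{s=1}^N Y_s$ when $\sum_{s=1}^N Y_s\neq0$, and let $\hat\mu_N=c_N$ when $\sum_{s=1}^N Y_s=0$, where $(c_N)_N$ is an arbitrary sequence of random variables (in particular, constants) that is bounded uniformly in $N$ and in the sample point. Then, as $N\to\infty$: 1. $\sqrt N(\hat\mu_N-\mu)$ converges in distribution to $\mathcal N(0,\sigma_\mu^2)$ (the point mass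 at $0$ if $\sigma_\mu=0$). 2. $\hat\mu_N$ has a finite second moment for every $N$, and $\mathrm{RMSE}_N:=\sqrt{\mathbb E[(\hat\mu_N-\mu)^2]}=\dfrac{\sigma_\mu}{\sqrt N}+o\!\left(\dfrac1{\sqrt N}\right).$ 3. $\mathbb E[\hat\mu_N]-\mu=\dfrac1N\,\dfrac{\mu\,\mathrm{Var}(Y_s)-\mathrm{Cov}(X_s,Y_s)}{\mu_Y^2}+o\!\left(\dfrac1N\right).$ 4. If $|\mu|\le\|O\|$, then $$\mathrm{RMSE}_N\le\frac{2\|O\|}{\sqrt N}\sqrt{\frac{\mathbb E[D_s]}{\mathbb E[\alpha_sD_s]^2}}+o\!\left(\frac1{\sqrt N}\right).$$ The condition $|\mu|\le\|O\|$ holds whenever $\mu=\mathrm{Tr}[O\rho]/\mathrm{Tr}[\rho]$ for some positive semidefinite operator $\rho$ with $\mathrm{Tr}[\rho]\neq0$. -/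

import Mathlib

open MeasureTheory ProbabilityTheory Filter Asymptotics Topology

noncomputable section

/-- The ratio estimator `(∑_{s<N} X s) / (∑_{s<N} Y s)` built from the first `N` samples. On the
event that the denominator vanishes, where the ratio is undefined, it returns the fallback value
`c N`. -/
def ratioEstimator {Ω : Type*} (X Y c : ℕ → Ω → ℝ) (N : ℕ) (ω : Ω) : ℝ :=
  if ∑ s ∈ Finset.range N, Y s ω = 0 then c N ω
  else (∑ s ∈ Finset.range N, X s ω) / (∑ s ∈ Finset.range N, Y s ω)

/-- Root-mean-square error of the estimator `est` of the real number `θ`. -/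
def rmse {Ω : Type*} [MeasurableSpace Ω] (P : Measure Ω) (est : Ω → ℝ) (θ : ℝ) : ℝ :=
  Real.sqrt (∫ ω, (est ω - θ) ^ 2 ∂P)

/-- Bias of the estimator `est` of the real number `θ`. -/
def bias {Ω : Type*} [MeasurableSpace Ω] (P : Measure Ω) (est : Ω → ℝ) (θ : ℝ) : ℝ :=
  (∫ ω, est ω ∂P) - θ

end

/-! ### Taylor expansion of a ratio, with control near a vanishing denominator -/

section Deterministic

/-! Put `m = μY`, `Z = X - μ Y`, `V = Y - m`; both `Z` and `V` are centered. Wherever the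
denominator is nonzero, the error of the estimator is exactly `s / (m + t)`, with `s`, `t` the
sample means of `Z`, `V`. Its linear part `s / m` gives the normal limit and the leading RMSE. The
next term `-s t / m ^ 2` has mean `-q / (m ^ 2 N)`, `q = Cov(X, Y) - μ Var(Y)`, which is the leading
bias.

The difficulty is moments when the denominator is small. Since `Y` is integer-valued, a nonzero
denominator sum has modulus at least 1, so the error is always `O(N)`. The expansion can fail only
when `|t| ≥ |m| / 2`, and there `1 ≤ (2 |t| / |m|) ^ (2 k)`. Hence the bad event costs at most a
constant times `N t ^ (2 k)`, whose mean is `O(N ^ (1 - k))` by sub-Gaussian moment bounds. The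
deterministic lemmas use `k = 2` and `k = 3`: the former term is squared for the mean-square error,
the latter is only averaged for the bias.

The coarse bound follows from `|Z| ≤ 2 ‖A‖ D` and `D ^ 2 = D`. -/

/-- First-order expansion of a ratio, with an error term that also covers small denominators. -/
lemma abs_ratio_sub_linear_le {m B n e s t : ℝ} (hm : m ≠ 0) (hn : 1 ≤ n)
    (he : |e| ≤ B * n) (hs : |s| ≤ B) (hst : m + t ≠ 0 → e = s / (m + t)) :
    |e - s / m| ≤ (2 / m ^ 2 + (B + B / |m|) * (2 / |m|) ^ 4) * (|s| * |t| + n * t ^ 4) := by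
  have hm' : 0 < |m| := abs_pos.2 hm
  have hB : 0 ≤ B := (abs_nonneg s).trans hs
  have hn0 : 0 ≤ n := by linarith
  -- For large `t` every term is `O(n)`, and a factor at least 1 turns this into `n * t ^ 4`; for
  -- small `t` the denominator is at least `|m| / 2` and the remainder is explicit.
  rcases le_or_gt (|m| / 2) |t| with ht | ht
  · have h1 : 1 ≤ (2 / |m|) ^ 4 * t ^ 4 := by
      have : 1 ≤ 2 / |m| * |t| := by
        rw [div_mul_eq_mul_div, le_div_iff₀ hm']; linarith
      calc (1 : ℝ) ≤ (2 / |m| * |t|) ^ 4 := one_le_pow₀ this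
        _ = _ := by rw [mul_pow, Even.pow_abs (by decide)]
    have h2 : |s / m| ≤ B / |m| * n := by
      rw [abs_div]
      calc |s| / |m| ≤ B / |m| := by gcongr
        _ ≤ _ := le_mul_of_one_le_right (by positivity) hn
    calc |e - s / m| ≤ |e| + |s / m| := abs_sub _ _
      _ ≤ (B + B / |m|) * n * 1 := by linarith
      _ ≤ (B + B / |m|) * n * ((2 / |m|) ^ 4 * t ^ 4) := by gcongr
      _ = ((B + B / |m|) * (2 / |m|) ^ 4) * (0 + n * t ^ 4) := by ring
      _ ≤ _ := by gcongr <;> first | positivity | (exact le_add_of_nonneg_left (by positivity))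
  · have hmt : |m| / 2 ≤ |m + t| := by
      have := abs_sub_abs_le_abs_sub m (-t)
      rw [abs_neg, sub_neg_eq_add] at this; linarith
    have hmt0 : m + t ≠ 0 := abs_pos.1 (by linarith)
    have h1 : e - s / m = -(s * t) / (m * (m + t)) := by
      rw [hst hmt0]; field_simp; ring
    have h2 : |e - s / m| ≤ 2 / m ^ 2 * (|s| * |t|) := by
      rw [h1, abs_div, abs_neg, abs_mul, abs_mul, ← sq_abs m]
      calc |s| * |t| / (|m| * |m + t|) ≤ |s| * |t| / (|m| * (|m| / 2)) := by gcongr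
        _ = _ := by field_simp
    refine h2.trans ?_
    have : 0 ≤ n * t ^ 4 := by positivity
    gcongr <;> first | (exact le_add_of_nonneg_right (by positivity))

/-- Second-order expansion of a ratio, with an error term that also covers small denominators. -/
lemma abs_ratio_sub_quadratic_le {m B n e s t : ℝ} (hm : m ≠ 0) (hn : 1 ≤ n)
    (he : |e| ≤ B * n) (hs : |s| ≤ B) (htB : |t| ≤ B) (hst : m + t ≠ 0 → e = s / (m + t)) :
    |e - s / m + s * t / m ^ 2| ≤
      (2 / |m| ^ 3 + (B + B / |m| + B * B / m ^ 2) * (2 / |m|) ^ 6) *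
        (|s| * t ^ 2 + n * t ^ 6) := by
  have hm' : 0 < |m| := abs_pos.2 hm
  have hB : 0 ≤ B := (abs_nonneg s).trans hs
  have hn0 : 0 ≤ n := by linarith
  rcases le_or_gt (|m| / 2) |t| with ht | ht
  · have h1 : 1 ≤ (2 / |m|) ^ 6 * t ^ 6 := by
      have : 1 ≤ 2 / |m| * |t| := by
        rw [div_mul_eq_mul_div, le_div_iff₀ hm']; linarith
      calc (1 : ℝ) ≤ (2 / |m| * |t|) ^ 6 := one_le_pow₀ this
        _ = _ := by rw [mul_pow, Even.pow_abs (by decide)]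
    have h2 : |s / m| ≤ B / |m| * n := by
      rw [abs_div]
      calc |s| / |m| ≤ B / |m| := by gcongr
        _ ≤ _ := le_mul_of_one_le_right (by positivity) hn
    have h3 : |s * t / m ^ 2| ≤ B * B / m ^ 2 * n := by
      rw [abs_div, abs_mul, abs_of_nonneg (sq_nonneg m)]
      calc |s| * |t| / m ^ 2 ≤ B * B / m ^ 2 := by gcongr
        _ ≤ _ := le_mul_of_one_le_right (by positivity) hn
    calc |e - s / m + s * t / m ^ 2| ≤ |e| + |s / m| + |s * t / m ^ 2| :=
          (abs_add_le _ _).trans (by gcongr; exact abs_sub _ _)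
      _ ≤ (B + B / |m| + B * B / m ^ 2) * n * 1 := by linarith
      _ ≤ (B + B / |m| + B * B / m ^ 2) * n * ((2 / |m|) ^ 6 * t ^ 6) := by gcongr
      _ = ((B + B / |m| + B * B / m ^ 2) * (2 / |m|) ^ 6) * (0 + n * t ^ 6) := by ring
      _ ≤ _ := by gcongr <;> first | positivity | (exact le_add_of_nonneg_left (by positivity))
  · have hmt : |m| / 2 ≤ |m + t| := by
      have := abs_sub_abs_le_abs_sub m (-t)
      rw [abs_neg, sub_neg_eq_add] at this; linarith
    have hmt0 : m + t ≠ 0 := abs_pos.1 (by linarith)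
    -- Exact remainder of the geometric expansion of `1 / (m + t)` after two terms.
    have h1 : e - s / m + s * t / m ^ 2 = s * t ^ 2 / (m ^ 2 * (m + t)) := by
      rw [hst hmt0]; field_simp; ring
    have h2 : |e - s / m + s * t / m ^ 2| ≤ 2 / |m| ^ 3 * (|s| * t ^ 2) := by
      rw [h1, abs_div, abs_mul, abs_mul, abs_pow, abs_pow, ← sq_abs t]
      calc |s| * |t| ^ 2 / (|m| ^ 2 * |m + t|) ≤ |s| * |t| ^ 2 / (|m| ^ 2 * (|m| / 2)) := by gcongr
        _ = _ := by field_simp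
    refine h2.trans ?_
    have : 0 ≤ n * t ^ 6 := by positivity
    gcongr <;> first | (exact le_add_of_nonneg_right (by positivity))

end Deterministic

/-! ### Expectation values and the operator norm -/

section Observable

/-- The expectation value of an operator in an unnormalized state is at most its norm. -/
lemma norm_trace_comp_le {H : Type*} [NormedAddCommGroup H] [InnerProductSpace ℂ H]
    [FiniteDimensional ℂ H] (A : H →L[ℂ] H) {ρ : H →ₗ[ℂ] H} (hρ : ρ.IsPositive) :
    ‖LinearMap.trace ℂ H ((A : H →ₗ[ℂ] H) ∘ₗ ρ)‖ ≤ ‖A‖ * ‖LinearMap.trace ℂ H ρ‖ := by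
  -- In an eigenbasis of `ρ` the trace is a sum of `⟨b i, A b i⟩` with nonnegative weights `l i`,
  -- whose total is the trace of `ρ`.
  set b := hρ.isSymmetric.eigenvectorBasis rfl with hb
  set l := hρ.isSymmetric.eigenvalues rfl with hl
  have hρb (i) : ρ (b i) = (l i : ℂ) • b i := hρ.isSymmetric.apply_eigenvectorBasis rfl i
  have hl0 (i) : 0 ≤ l i := hρ.nonneg_eigenvalues rfl i
  have h1 : LinearMap.trace ℂ H ρ = ((∑ i, l i : ℝ) : ℂ) := by
    rw [LinearMap.trace_eq_sum_inner ρ b]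
    push_cast
    refine Finset.sum_congr rfl fun i _ => ?_
    rw [hρb, inner_smul_right, inner_self_eq_norm_sq_to_K, b.norm_eq_one]; simp
  rw [h1, LinearMap.trace_eq_sum_inner _ b, Complex.norm_real, Real.norm_eq_abs,
    abs_of_nonneg (Finset.sum_nonneg fun i _ => hl0 i), Finset.mul_sum]
  refine (norm_sum_le _ _).trans (Finset.sum_le_sum fun i _ => ?_)
  rw [LinearMap.comp_apply, hρb, map_smul, inner_smul_right, norm_mul, Complex.norm_real,
    Real.norm_eq_abs, abs_of_nonneg (hl0 i), mul_comm]
  gcongr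
  · exact hl0 i
  calc ‖inner ℂ (b i) (A (b i))‖ ≤ ‖b i‖ * ‖A (b i)‖ := norm_inner_le_norm _ _
    _ ≤ ‖b i‖ * (‖A‖ * ‖b i‖) := by gcongr; exact A.le_opNorm _
    _ = ‖A‖ := by rw [b.norm_eq_one]; ring

end Observable

/-! ### Moments of sample means -/

section Moments

/-- Mean of the first `N` terms of a sequence of random variables. -/
noncomputable def sampleMean {Ω : Type*} (Z : ℕ → Ω → ℝ) (N : ℕ) (ω : Ω) : ℝ := (∑ s ∈ Finset.range N, Z s ω) / N

lemma abs_sampleMean_le {Ω : Type*} {Z : ℕ → Ω → ℝ} {B : ℝ} (hB : ∀ s ω, |Z s ω| ≤ B) {N : ℕ} (hN : N ≠ 0)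
    (ω : Ω) : |sampleMean Z N ω| ≤ B := by
  have : (0 : ℝ) < N := by positivity
  rw [sampleMean, abs_div, Nat.abs_cast, div_le_iff₀ this]
  refine (Finset.abs_sum_le_sum_abs _ _).trans ?_
  refine (Finset.sum_le_card_nsmul _ _ B fun s _ => hB s ω).trans ?_
  simp [mul_comm]

variable {Ω : Type*} [MeasurableSpace Ω] {P : Measure Ω}

/-- Even moments of a sub-Gaussian random variable. -/
lemma ProbabilityTheory.HasSubgaussianMGF.integral_pow_two_mul_le {U : Ω → ℝ} {v : NNReal}
    (hU : HasSubgaussianMGF U v P) (k : ℕ) :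
    ∫ ω, U ω ^ (2 * k) ∂P ≤ 2 * (2 * k).factorial * Real.exp (v / 2) := by
  have h1 := hU.integrable_exp_mul 1
  have h2 := hU.integrable_exp_mul (-1)
  have h3 := hU.mgf_le 1
  have h4 := hU.mgf_le (-1)
  simp only [mgf, one_mul, neg_mul, one_pow, even_two.neg_pow, mul_one] at h1 h2 h3 h4
  have hf : (0 : ℝ) < (2 * k).factorial := by positivity
  calc ∫ ω, U ω ^ (2 * k) ∂P
      ≤ ∫ ω, (2 * k).factorial * (Real.exp (U ω) + Real.exp (-U ω)) ∂P := by
        refine integral_mono_of_nonneg (ae_of_all _ fun ω => (even_two_mul k).pow_nonneg _)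
          ((h1.add h2).const_mul _) (ae_of_all _ fun ω => ?_)
        -- One term of the exponential series bounds the power, and `exp |U| ≤ exp U + exp (-U)`.
        have := Real.pow_div_factorial_le_exp |U ω| (abs_nonneg _) (2 * k)
        rw [(even_two_mul k).pow_abs, div_le_iff₀ hf] at this
        exact (this.trans (mul_le_mul_of_nonneg_right (Real.exp_abs_le _) hf.le)).trans_eq
          (mul_comm _ _)
    _ = (2 * k).factorial * ((∫ ω, Real.exp (U ω) ∂P) + ∫ ω, Real.exp (-U ω) ∂P) := by
        rw [integral_const_mul, integral_add h1 h2]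
    _ ≤ (2 * k).factorial * (Real.exp (v / 2) + Real.exp (v / 2)) := by gcongr
    _ = _ := by ring

lemma measurable_sampleMean {Z : ℕ → Ω → ℝ} (hZ : ∀ s, Measurable (Z s)) (N : ℕ) :
    Measurable (sampleMean Z N) := by
  unfold sampleMean; fun_prop

/-- Even moments of the mean of bounded independent centered random variables. -/
lemma exists_integral_sampleMean_pow_le [IsProbabilityMeasure P] {Z : ℕ → Ω → ℝ} {B : ℝ}
    (hZm : ∀ s, Measurable (Z s)) (hB : ∀ s ω, |Z s ω| ≤ B) (hZ0 : ∀ s, ∫ ω, Z s ω ∂P = 0)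
    (hind : iIndepFun Z P) (k : ℕ) :
    ∃ C, 0 ≤ C ∧ ∀ N : ℕ, N ≠ 0 → ∫ ω, sampleMean Z N ω ^ (2 * k) ∂P ≤ C / N ^ k := by
  -- Variance proxy from Hoeffding's lemma on `[-B, B]`.
  set v : NNReal := (‖B - (-B)‖₊ / 2) ^ 2
  have hsub (s) : HasSubgaussianMGF (Z s) v P :=
    hasSubgaussianMGF_of_mem_Icc_of_integral_eq_zero (hZm s).aemeasurable
      (ae_of_all _ fun ω => abs_le.1 (hB s ω)) (hZ0 s)
  refine ⟨2 * (2 * k).factorial * Real.exp (v / 2), by positivity, fun N hN => ?_⟩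
  have hN' : (0 : ℝ) < N := by positivity
  have hsum := HasSubgaussianMGF.sum_of_iIndepFun hind (s := Finset.range N) (c := fun _ => v)
    fun s _ => hsub s
  -- After scaling the sum by `1 / √N` the proxy is `v` for every `N`, so the constant is uniform.
  have h := (hsum.const_mul (Real.sqrt N)⁻¹).integral_pow_two_mul_le k
  have hv : ((⟨(Real.sqrt N)⁻¹ ^ 2, sq_nonneg _⟩ * ∑ _s ∈ Finset.range N, v : NNReal) : ℝ) = v := by
    change (Real.sqrt N)⁻¹ ^ 2 * ((∑ _s ∈ Finset.range N, v : NNReal) : ℝ) = v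
    rw [Finset.sum_const, Finset.card_range, nsmul_eq_mul, inv_pow, Real.sq_sqrt hN'.le]
    push_cast
    field_simp
  rw [hv] at h
  rw [le_div_iff₀ (by positivity), ← integral_mul_const]
  refine le_of_eq_of_le (integral_congr_ae (ae_of_all _ fun ω => ?_)) h
  simp only [sampleMean]
  rw [mul_pow, inv_pow, pow_mul (Real.sqrt N), Real.sq_sqrt hN'.le, div_pow]
  field_simp
  ring

lemma integral_sampleMean {Z : ℕ → Ω → ℝ} (hZi : ∀ s, Integrable (Z s) P)
    (hZ0 : ∀ s, ∫ ω, Z s ω ∂P = 0) (N : ℕ) : ∫ ω, sampleMean Z N ω ∂P = 0 := by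
  simp only [sampleMean]
  rw [integral_div, integral_finsetSum _ fun s _ => hZi s]
  simp [hZ0]

/-- Second mixed moment of the means of two jointly independent centered sequences. -/
lemma integral_sampleMean_mul_sampleMean [IsProbabilityMeasure P] {Z V : ℕ → Ω → ℝ} {B : ℝ}
    (hZm : ∀ s, Measurable (Z s)) (hVm : ∀ s, Measurable (V s))
    (hZB : ∀ s ω, |Z s ω| ≤ B) (hVB : ∀ s ω, |V s ω| ≤ B)
    (hZ0 : ∀ s, ∫ ω, Z s ω ∂P = 0) {q : ℝ} (hq : ∀ s, ∫ ω, Z s ω * V s ω ∂P = q)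
    (hind : ∀ i j, i ≠ j → IndepFun (Z i) (V j) P) {N : ℕ} (hN : N ≠ 0) :
    ∫ ω, sampleMean Z N ω * sampleMean V N ω ∂P = q / N := by
  have hN' : (N : ℝ) ≠ 0 := by positivity
  have hint (i j) : Integrable (fun ω => Z i ω * V j ω) P := by
    refine Integrable.of_bound ((hZm i).mul (hVm j)).aestronglyMeasurable (B * B)
      (ae_of_all _ fun ω => ?_)
    rw [norm_mul]
    have : 0 ≤ B := (abs_nonneg _).trans (hZB i ω)
    exact mul_le_mul (hZB i ω) (hVB j ω) (norm_nonneg _) this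
  have h (ω) : sampleMean Z N ω * sampleMean V N ω =
      (∑ i ∈ Finset.range N, ∑ j ∈ Finset.range N, Z i ω * V j ω) / (N * N) := by
    rw [sampleMean, sampleMean, div_mul_div_comm, Finset.sum_mul_sum]
  simp_rw [h]
  rw [integral_div, integral_finsetSum _ fun i _ => integrable_finsetSum _ fun j _ => hint i j]
  have h2 (i) (hi : i ∈ Finset.range N) :
      ∫ ω, ∑ j ∈ Finset.range N, Z i ω * V j ω ∂P = q := by
    -- Off the diagonal the factors are independent and `Z i` is centered.
    rw [integral_finsetSum _ fun j _ => hint i j, Finset.sum_eq_single_of_mem i hi, hq]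
    intro j _ hj
    rw [(hind i j hj.symm).integral_fun_mul_eq_mul_integral (hZm i).aestronglyMeasurable
      (hVm j).aestronglyMeasurable, hZ0, zero_mul]
  rw [Finset.sum_congr rfl h2]
  simp
  field_simp

end Moments

/-! ### Asymptotics of an abstract ratio error -/

section RatioError

variable {Ω : Type*} [MeasurableSpace Ω] {P : Measure Ω}

/-- `e N` is the ratio of the means of the first `N` terms of `Z` and of `m + V`, up to a crude bound
where the denominator vanishes; `Z` and `V` are bounded i.i.d. centered sequences with common
covariance `q`, independent of each other at different times. -/
structure IsRatioError (P : Measure Ω) (Z V e : ℕ → Ω → ℝ) (m B q : ℝ) : Prop where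
  ne_zero : m ≠ 0
  measurable_num : ∀ s, Measurable (Z s)
  measurable_den : ∀ s, Measurable (V s)
  measurable_err : ∀ N, Measurable (e N)
  abs_num_le : ∀ s ω, |Z s ω| ≤ B
  abs_den_le : ∀ s ω, |V s ω| ≤ B
  abs_err_le : ∀ N, N ≠ 0 → ∀ ω, |e N ω| ≤ B * N
  integral_num : ∀ s, ∫ ω, Z s ω ∂P = 0
  integral_den : ∀ s, ∫ ω, V s ω ∂P = 0
  integral_mul : ∀ s, ∫ ω, Z s ω * V s ω ∂P = q
  iIndepFun_num : iIndepFun Z P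
  iIndepFun_den : iIndepFun V P
  indepFun : ∀ i j, i ≠ j → IndepFun (Z i) (V j) P
  identDistrib_num : ∀ s, IdentDistrib (Z s) (Z 0) P P
  err_eq : ∀ N, N ≠ 0 → ∀ ω, m + sampleMean V N ω ≠ 0 →
    e N ω = sampleMean Z N ω / (m + sampleMean V N ω)

/-- A bounded measurable function is in every `L^p` of a finite measure. -/
lemma memLp_of_abs_le [IsFiniteMeasure P] {f : Ω → ℝ} (hf : Measurable f) {b : ℝ}
    (hb : ∀ ω, |f ω| ≤ b) (p : ENNReal) : MemLp f p P :=
  MemLp.of_bound hf.aestronglyMeasurable b (ae_of_all _ hb)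

lemma lpNorm_two_eq_sqrt {f : Ω → ℝ} (hf : AEStronglyMeasurable f P) :
    lpNorm f 2 P = Real.sqrt (∫ ω, f ω ^ 2 ∂P) := by
  rw [lpNorm_eq_integral_norm_rpow_toReal (by norm_num) (by norm_num) hf, Real.sqrt_eq_rpow]
  simp

namespace IsRatioError

variable [IsProbabilityMeasure P] {Z V e : ℕ → Ω → ℝ} {m B q : ℝ}

variable (h : IsRatioError P Z V e m B q)
include h

lemma memLp_num {N : ℕ} (hN : N ≠ 0) (p : ENNReal) : MemLp (sampleMean Z N) p P :=
  memLp_of_abs_le (measurable_sampleMean h.measurable_num N) (abs_sampleMean_le h.abs_num_le hN) p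

lemma memLp_err {N : ℕ} (hN : N ≠ 0) (p : ENNReal) : MemLp (e N) p P :=
  memLp_of_abs_le (h.measurable_err N) (h.abs_err_le N hN) p

lemma integrable_num_pow {N : ℕ} (hN : N ≠ 0) (k : ℕ) :
    Integrable (fun ω => sampleMean Z N ω ^ k) P :=
  Integrable.of_bound ((measurable_sampleMean h.measurable_num N).pow_const k).aestronglyMeasurable
    (B ^ k) (ae_of_all _ fun ω => by
      rw [norm_pow]; exact pow_le_pow_left₀ (norm_nonneg _) (abs_sampleMean_le h.abs_num_le hN ω) k)

lemma integrable_den_pow {N : ℕ} (hN : N ≠ 0) (k : ℕ) :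
    Integrable (fun ω => sampleMean V N ω ^ k) P :=
  Integrable.of_bound ((measurable_sampleMean h.measurable_den N).pow_const k).aestronglyMeasurable
    (B ^ k) (ae_of_all _ fun ω => by
      rw [norm_pow]; exact pow_le_pow_left₀ (norm_nonneg _) (abs_sampleMean_le h.abs_den_le hN ω) k)

/-- Mean-square error of the linearization of the ratio. -/
lemma exists_integral_sub_linear_sq_le :
    ∃ C, 0 ≤ C ∧ ∀ N : ℕ, N ≠ 0 →
      ∫ ω, (e N ω - sampleMean Z N ω / m) ^ 2 ∂P ≤ C / (N : ℝ) ^ 2 := by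
  obtain ⟨C1, hC1, h1⟩ := exists_integral_sampleMean_pow_le h.measurable_num h.abs_num_le
    h.integral_num h.iIndepFun_num 2
  obtain ⟨C2, hC2, h2⟩ := exists_integral_sampleMean_pow_le h.measurable_den h.abs_den_le
    h.integral_den h.iIndepFun_den 2
  obtain ⟨C4, hC4, h4⟩ := exists_integral_sampleMean_pow_le h.measurable_den h.abs_den_le
    h.integral_den h.iIndepFun_den 4
  set K := 2 / m ^ 2 + (B + B / |m|) * (2 / |m|) ^ 4 with hK
  refine ⟨2 * K ^ 2 * (C1 + C2 + C4), by positivity, fun N hN => ?_⟩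
  have hN1 : (1 : ℝ) ≤ N := by exact_mod_cast Nat.one_le_iff_ne_zero.2 hN
  have i1 := h.integrable_num_pow hN (2 * 2)
  have i2 := h.integrable_den_pow hN (2 * 2)
  have i12 : Integrable (fun ω => sampleMean Z N ω ^ (2 * 2) + sampleMean V N ω ^ (2 * 2)) P :=
    i1.add i2
  have i4 := (h.integrable_den_pow hN (2 * 4)).const_mul ((N : ℝ) ^ 2)
  calc ∫ ω, (e N ω - sampleMean Z N ω / m) ^ 2 ∂P
      ≤ ∫ ω, 2 * K ^ 2 * (sampleMean Z N ω ^ (2 * 2) + sampleMean V N ω ^ (2 * 2)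
          + (N : ℝ) ^ 2 * sampleMean V N ω ^ (2 * 4)) ∂P := by
        refine integral_mono_of_nonneg (ae_of_all _ fun ω => sq_nonneg _)
          ((i12.add i4).const_mul _) (ae_of_all _ fun ω => ?_)
        beta_reduce
        have := abs_ratio_sub_linear_le h.ne_zero hN1 (h.abs_err_le N hN ω)
          (abs_sampleMean_le h.abs_num_le hN ω) (h.err_eq N hN ω)
        rw [← hK] at this
        generalize sampleMean Z N ω = s at *
        generalize sampleMean V N ω = t at *
        -- Squaring leaves fourth moments, of order `1 / N ^ 2`, and `N ^ 2 * t ^ 8`, of order `N ^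
        -- 2 / N ^ 4`.
        have h5 : (|s| * |t|) ^ 2 ≤ s ^ 4 + t ^ 4 := by
          rw [mul_pow, sq_abs, sq_abs]; nlinarith [sq_nonneg (s ^ 2 - t ^ 2), sq_nonneg (s ^ 2),
            sq_nonneg (t ^ 2)]
        have h6 : (|s| * |t| + N * t ^ 4) ^ 2 ≤ 2 * ((|s| * |t|) ^ 2 + (N * t ^ 4) ^ 2) := by
          nlinarith [sq_nonneg (|s| * |t| - N * t ^ 4)]
        calc (e N ω - s / m) ^ 2 = |e N ω - s / m| ^ 2 := (sq_abs _).symm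
          _ ≤ (K * (|s| * |t| + N * t ^ 4)) ^ 2 := by gcongr
          _ = K ^ 2 * (|s| * |t| + N * t ^ 4) ^ 2 := mul_pow _ _ _
          _ ≤ K ^ 2 * (2 * ((s ^ 4 + t ^ 4) + (N * t ^ 4) ^ 2)) := by
            gcongr; exact h6.trans (by gcongr)
          _ = _ := by ring
    _ = 2 * K ^ 2 * ((∫ ω, sampleMean Z N ω ^ (2 * 2) ∂P) + (∫ ω, sampleMean V N ω ^ (2 * 2) ∂P)
          + (N : ℝ) ^ 2 * ∫ ω, sampleMean V N ω ^ (2 * 4) ∂P) := by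
        rw [integral_const_mul, integral_add i12 i4, integral_add i1 i2,
          integral_const_mul]
    _ ≤ 2 * K ^ 2 * (C1 / (N : ℝ) ^ 2 + C2 / (N : ℝ) ^ 2 + (N : ℝ) ^ 2 * (C4 / (N : ℝ) ^ 4)) := by
        gcongr
        exacts [h1 N hN, h2 N hN, h4 N hN]
    _ = _ := by field_simp

/-- Mean error of the second-order expansion of the ratio. -/
lemma exists_integral_abs_sub_quadratic_le :
    ∃ C, 0 ≤ C ∧ ∀ N : ℕ, N ≠ 0 →
      ∫ ω, |e N ω - sampleMean Z N ω / m + sampleMean Z N ω * sampleMean V N ω / m ^ 2| ∂P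
        ≤ C / (N * Real.sqrt N) := by
  obtain ⟨C1, hC1, h1⟩ := exists_integral_sampleMean_pow_le h.measurable_num h.abs_num_le
    h.integral_num h.iIndepFun_num 1
  obtain ⟨C2, hC2, h2⟩ := exists_integral_sampleMean_pow_le h.measurable_den h.abs_den_le
    h.integral_den h.iIndepFun_den 2
  obtain ⟨C3, hC3, h3⟩ := exists_integral_sampleMean_pow_le h.measurable_den h.abs_den_le
    h.integral_den h.iIndepFun_den 3
  have hB : 0 ≤ B := by
    obtain ⟨ω⟩ := P.nonempty_of_neZero
    exact (abs_nonneg _).trans (h.abs_num_le 0 ω)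
  set K := 2 / |m| ^ 3 + (B + B / |m| + B * B / m ^ 2) * (2 / |m|) ^ 6 with hK
  have hK0 : 0 ≤ K := by positivity
  refine ⟨K * (C1 + C2 + C3), by positivity, fun N hN => ?_⟩
  have hN1 : (1 : ℝ) ≤ N := by exact_mod_cast Nat.one_le_iff_ne_zero.2 hN
  set r := Real.sqrt N with hr
  have hr1 : 1 ≤ r := Real.one_le_sqrt.2 hN1
  have hr0 : 0 < r := by linarith
  have hNr : (N : ℝ) = r ^ 2 := (Real.sq_sqrt (by positivity)).symm
  -- The weights `1 / r` and `r`, with `r = √N`, balance `|s| * t ^ 2` between `s ^ 2` (order `1 /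
  -- N`) and `t ^ 4` (order `1 / N ^ 2`): both give `N ^ (-3/2)`.
  have i1 := (h.integrable_num_pow hN (2 * 1)).const_mul (1 / r)
  have i2 := (h.integrable_den_pow hN (2 * 2)).const_mul r
  have i12 : Integrable (fun ω => 1 / r * sampleMean Z N ω ^ (2 * 1)
      + r * sampleMean V N ω ^ (2 * 2)) P := i1.add i2
  have i3 := (h.integrable_den_pow hN (2 * 3)).const_mul (N : ℝ)
  calc ∫ ω, |e N ω - sampleMean Z N ω / m + sampleMean Z N ω * sampleMean V N ω / m ^ 2| ∂P
      ≤ ∫ ω, K * (1 / r * sampleMean Z N ω ^ (2 * 1) + r * sampleMean V N ω ^ (2 * 2)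
          + N * sampleMean V N ω ^ (2 * 3)) ∂P := by
        refine integral_mono_of_nonneg (ae_of_all _ fun ω => abs_nonneg _)
          ((i12.add i3).const_mul _) (ae_of_all _ fun ω => ?_)
        have := abs_ratio_sub_quadratic_le h.ne_zero hN1 (h.abs_err_le N hN ω)
          (abs_sampleMean_le h.abs_num_le hN ω) (abs_sampleMean_le h.abs_den_le hN ω)
          (h.err_eq N hN ω)
        rw [← hK] at this
        refine this.trans ?_
        simp only
        generalize sampleMean Z N ω = s at *
        generalize sampleMean V N ω = t at *
        gcongr
        have h6 : 0 ≤ (|s| - r * t ^ 2) ^ 2 / r := by positivity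
        have h7 : (|s| - r * t ^ 2) ^ 2 / r = 1 / r * s ^ 2 + r * t ^ 4 - 2 * (|s| * t ^ 2) := by
          rw [← sq_abs s]; field_simp; ring
        have h8 : 0 ≤ |s| * t ^ 2 := by positivity
        norm_num only
        linarith
    _ = K * (1 / r * (∫ ω, sampleMean Z N ω ^ (2 * 1) ∂P) +
          r * (∫ ω, sampleMean V N ω ^ (2 * 2) ∂P)
          + N * ∫ ω, sampleMean V N ω ^ (2 * 3) ∂P) := by
        rw [integral_const_mul, integral_add i12 i3, integral_add i1 i2,
          integral_const_mul, integral_const_mul, integral_const_mul]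
    _ ≤ K * (1 / r * (C1 / (N : ℝ) ^ 1) + r * (C2 / (N : ℝ) ^ 2) + N * (C3 / (N : ℝ) ^ 3)) := by
        gcongr
        exacts [h1 N hN, h2 N hN, h3 N hN]
    _ = K * (C1 + C2 + C3 / r) / (N * r) := by rw [hNr]; field_simp
    _ ≤ K * (C1 + C2 + C3) / (N * r) := by
        gcongr
        exact div_le_self hC3 hr1

/-- The norm form serves both the reverse triangle inequality for the RMSE and convergence in
measure for the limit law. -/
lemma exists_lpNorm_sub_linear_le :
    ∃ C, 0 ≤ C ∧ ∀ N : ℕ, N ≠ 0 →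
      lpNorm (e N - fun ω => sampleMean Z N ω / m) 2 P ≤ C / N := by
  obtain ⟨C, hC, hle⟩ := h.exists_integral_sub_linear_sq_le
  refine ⟨Real.sqrt C, Real.sqrt_nonneg _, fun N hN => ?_⟩
  rw [lpNorm_two_eq_sqrt ((h.measurable_err N).sub
    ((measurable_sampleMean h.measurable_num N).div_const m)).aestronglyMeasurable]
  refine (Real.sqrt_le_sqrt (hle N hN)).trans_eq ?_
  rw [Real.sqrt_div hC, Real.sqrt_sq (by positivity)]

/-- The root-mean-square error of the ratio is that of its linearization, to leading order. -/
theorem isLittleO_sqrt_integral_sq {v : ℝ} (hv : ∀ s, ∫ ω, Z s ω * Z s ω ∂P = v) :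
    (fun N : ℕ => Real.sqrt (∫ ω, e N ω ^ 2 ∂P) - Real.sqrt (v / m ^ 2) / Real.sqrt N)
      =o[atTop] fun N : ℕ => 1 / Real.sqrt N := by
  obtain ⟨C, hC, hle⟩ := h.exists_lpNorm_sub_linear_le
  -- The difference of the two `L^2` norms is at most the norm of the difference, hence even `O(1 /
  -- N)`.
  have hbig : (fun N : ℕ => Real.sqrt (∫ ω, e N ω ^ 2 ∂P) - Real.sqrt (v / m ^ 2) / Real.sqrt N)
      =O[atTop] fun N : ℕ => 1 / (N : ℝ) := by
    refine IsBigO.of_bound C ?_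
    filter_upwards [eventually_ne_atTop 0] with N hN
    have hN0 : (0 : ℝ) < N := by positivity
    have hs : MemLp (fun ω => sampleMean Z N ω / m) 2 P := by
      simpa only [div_eq_mul_inv] using (h.memLp_num hN 2).mul_const m⁻¹
    have he := h.memLp_err hN 2
    have h0 : lpNorm (fun ω => sampleMean Z N ω / m) 2 P =
        Real.sqrt (v / m ^ 2) / Real.sqrt N := by
      rw [lpNorm_two_eq_sqrt hs.1, ← Real.sqrt_div' _ hN0.le]
      congr 1
      simp_rw [div_pow]
      rw [integral_div]
      simp_rw [pow_two (sampleMean Z N _)]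
      rw [integral_sampleMean_mul_sampleMean h.measurable_num h.measurable_num h.abs_num_le
        h.abs_num_le h.integral_num hv (fun i j hij => h.iIndepFun_num.indepFun hij) hN]
      exact div_right_comm _ _ _
    rw [← lpNorm_two_eq_sqrt he.1, ← h0, Real.norm_eq_abs, Real.norm_of_nonneg (by positivity),
      mul_one_div]
    refine le_trans ?_ (hle N hN)
    rw [abs_le]
    have h1 := lpNorm_le_lpNorm_add_lpNorm_sub' (f := e N) hs (p := 2) (by norm_num)
    have h2 := lpNorm_le_lpNorm_add_lpNorm_sub' (f := fun ω => sampleMean Z N ω / m) he (p := 2)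
      (by norm_num)
    rw [lpNorm_sub_comm] at h2
    constructor <;> linarith
  refine hbig.trans_isLittleO ?_
  rw [isLittleO_iff_tendsto' (by
    filter_upwards [eventually_ne_atTop 0] with N hN h0
    have : (0 : ℝ) < N := by positivity
    exact absurd h0 (by positivity))]
  refine (tendsto_inv_atTop_zero.comp
    (Real.tendsto_sqrt_atTop.comp tendsto_natCast_atTop_atTop)).congr' ?_
  filter_upwards [eventually_ne_atTop 0] with N hN
  have : (0 : ℝ) < N := by positivity
  have h2 := Real.sq_sqrt this.le
  have h3 := Real.sqrt_pos.2 this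
  simp only [Function.comp]
  field_simp
  exact h2.symm

/-- The bias of the ratio, to second order. -/
theorem isLittleO_integral_sub :
    (fun N : ℕ => (∫ ω, e N ω ∂P) - 1 / (N : ℝ) * (-q / m ^ 2))
      =o[atTop] fun N : ℕ => 1 / (N : ℝ) := by
  obtain ⟨C, hC, hle⟩ := h.exists_integral_abs_sub_quadratic_le
  have hbig : (fun N : ℕ => (∫ ω, e N ω ∂P) - 1 / (N : ℝ) * (-q / m ^ 2))
      =O[atTop] fun N : ℕ => 1 / (N * Real.sqrt N) := by
    refine IsBigO.of_bound C ?_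
    filter_upwards [eventually_ne_atTop 0] with N hN
    have hN0 : (0 : ℝ) < N := by positivity
    have is : Integrable (sampleMean Z N) P := (h.memLp_num hN 1).integrable le_rfl
    have it : MemLp (sampleMean V N) 2 P :=
      memLp_of_abs_le (measurable_sampleMean h.measurable_den N)
        (abs_sampleMean_le h.abs_den_le hN) 2
    have ist : Integrable (fun ω => sampleMean Z N ω * sampleMean V N ω) P :=
      (h.memLp_num hN 2).integrable_mul it
    have ie : Integrable (e N) P := (h.memLp_err hN 1).integrable le_rfl
    have ies : Integrable (fun ω => e N ω - sampleMean Z N ω / m) P := ie.sub (is.div_const m)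
    -- Exact: the linear term has mean zero and the product term has mean `q / (N m ^ 2)`.
    have h0 : (∫ ω, e N ω ∂P) - 1 / (N : ℝ) * (-q / m ^ 2) = ∫ ω, (e N ω - sampleMean Z N ω / m
        + sampleMean Z N ω * sampleMean V N ω / m ^ 2) ∂P := by
      rw [integral_add ies (ist.div_const _), integral_sub ie (is.div_const m),
        integral_div, integral_div, integral_sampleMean (fun s => (memLp_of_abs_le
          (h.measurable_num s) (h.abs_num_le s) 1).integrable le_rfl) h.integral_num,
        integral_sampleMean_mul_sampleMean h.measurable_num h.measurable_den h.abs_num_le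
        h.abs_den_le h.integral_num h.integral_mul h.indepFun hN]
      ring
    rw [h0, Real.norm_of_nonneg (r := 1 / ((N : ℝ) * Real.sqrt N)) (by positivity), mul_one_div]
    exact (norm_integral_le_integral_norm _).trans (hle N hN)
  refine hbig.trans_isLittleO ?_
  rw [isLittleO_iff_tendsto' (by
    filter_upwards [eventually_ne_atTop 0] with N hN h0
    have : (0 : ℝ) < N := by positivity
    exact absurd h0 (by positivity))]
  refine (tendsto_inv_atTop_zero.comp
    (Real.tendsto_sqrt_atTop.comp tendsto_natCast_atTop_atTop)).congr' ?_
  filter_upwards [eventually_ne_atTop 0] with N hN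
  have : (0 : ℝ) < N := by positivity
  have h3 := Real.sqrt_pos.2 this
  simp only [Function.comp]
  field_simp

/-- Central limit theorem for the ratio. -/
theorem tendstoInDistribution :
    TendstoInDistribution (fun (N : ℕ) ω => Real.sqrt N * e N ω) atTop (id : ℝ → ℝ) (fun _ => P)
      (gaussianReal 0 (Real.toNNReal Var[fun ω => Z 0 ω / m; P])) := by
  have hlaw : HasLaw (id : ℝ → ℝ) (gaussianReal 0 (Var[fun ω => Z 0 ω / m; P]).toNNReal)
      (gaussianReal 0 (Real.toNNReal Var[fun ω => Z 0 ω / m; P])) := HasLaw.id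
  have hmem : MemLp (fun ω => Z 0 ω / m) 2 P := by
    simpa only [div_eq_mul_inv] using
      (memLp_of_abs_le (h.measurable_num 0) (h.abs_num_le 0) 2).mul_const m⁻¹
  have hclt := tendstoInDistribution_inv_sqrt_mul_sum_sub (X := fun s ω => Z s ω / m) hlaw hmem
    (h.iIndepFun_num.comp (fun _ x => x / m) fun _ => by fun_prop)
    (fun s => (h.identDistrib_num s).comp (u := fun x => x / m) (by fun_prop))
  -- Slutsky: the linear part obeys the central limit theorem, and `√N` times the linearization
  -- error is `O(1 / √N)` in `L^2`.
  refine tendstoInDistribution_of_tendstoInMeasure_sub _ _ hclt ?_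
    fun N => ((h.measurable_err N).const_mul _).aemeasurable
  have hm := measurable_sampleMean h.measurable_num
  have hsub : ((fun (N : ℕ) ω => Real.sqrt N * e N ω) - fun (N : ℕ) ω => (Real.sqrt N)⁻¹ *
      (∑ k ∈ Finset.range N, Z k ω / m - N * ∫ ω, Z 0 ω / m ∂P)) =
      fun (N : ℕ) => Real.sqrt N • (e N - fun ω => sampleMean Z N ω / m) := by
    funext N ω
    simp only [Pi.sub_apply, Pi.smul_apply, smul_eq_mul, sampleMean]
    rw [integral_div, h.integral_num, zero_div, mul_zero, sub_zero, ← Finset.sum_div, mul_sub]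
    congr 1
    rw [inv_eq_one_div, ← Real.sqrt_div_self']
    ring
  rw [hsub]
  have hmeas (N : ℕ) : AEStronglyMeasurable
      (Real.sqrt N • (e N - fun ω => sampleMean Z N ω / m)) P :=
    (((h.measurable_err N).sub ((hm N).div_const m)).aestronglyMeasurable).const_smul _
  refine tendstoInMeasure_of_tendsto_eLpNorm (p := 2) (by norm_num) hmeas
    aestronglyMeasurable_const ?_
  obtain ⟨C, hC, hle⟩ := h.exists_lpNorm_sub_linear_le
  have hlim : Tendsto (fun N : ℕ => ENNReal.ofReal (C * (Real.sqrt N)⁻¹)) atTop (𝓝 0) := by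
    rw [← ENNReal.ofReal_zero, ← mul_zero C]
    exact ENNReal.tendsto_ofReal ((tendsto_inv_atTop_zero.comp
      (Real.tendsto_sqrt_atTop.comp tendsto_natCast_atTop_atTop)).const_mul C)
  refine tendsto_of_tendsto_of_tendsto_of_le_of_le' tendsto_const_nhds hlim
    (Eventually.of_forall fun _ => zero_le) ?_
  filter_upwards [eventually_ne_atTop 0] with N hN
  have hN0 : (0 : ℝ) < N := by positivity
  have hs : MemLp (fun ω => sampleMean Z N ω / m) 2 P := by
    simpa only [div_eq_mul_inv] using (h.memLp_num hN 2).mul_const m⁻¹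
  rw [sub_zero, ← ofReal_lpNorm (((h.memLp_err hN 2).sub hs).const_smul _), lpNorm_const_smul]
  refine ENNReal.ofReal_le_ofReal ?_
  rw [coe_nnnorm, Real.norm_of_nonneg (Real.sqrt_nonneg _)]
  calc Real.sqrt N * lpNorm (e N - fun ω => sampleMean Z N ω / m) 2 P
      ≤ Real.sqrt N * (C / N) := by gcongr; exact hle N hN
    _ = C * (Real.sqrt N / N) := by ring
    _ = _ := by rw [Real.sqrt_div_self', one_div]

end IsRatioError

end RatioError

/-! ### The ratio estimator as a ratio error -/

section RatioEstimator

variable {Ω : Type*}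

lemma measurable_ratioEstimator [MeasurableSpace Ω] {X Y c : ℕ → Ω → ℝ}
    (hX : ∀ s, Measurable (X s)) (hY : ∀ s, Measurable (Y s)) (hc : ∀ N, Measurable (c N)) (N : ℕ) :
    Measurable (ratioEstimator X Y c N) := by
  have hs : Measurable fun ω => ∑ s ∈ Finset.range N, Y s ω := by fun_prop
  have hx : Measurable fun ω => ∑ s ∈ Finset.range N, X s ω := by fun_prop
  exact Measurable.ite (hs (measurableSet_singleton 0)) (hc N) (hx.div hs)

/-- If the denominators are sums of integers, the ratio estimator grows at most linearly. -/
lemma abs_ratioEstimator_le {X Y c : ℕ → Ω → ℝ} {a C : ℝ} (hX : ∀ s ω, |X s ω| ≤ a)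
    (hY : ∀ s ω, ∃ k : ℤ, Y s ω = k) (hc : ∀ N ω, |c N ω| ≤ C) (N : ℕ) (ω : Ω) :
    |ratioEstimator X Y c N ω| ≤ a * N + C := by
  have ha : 0 ≤ a := (abs_nonneg _).trans (hX 0 ω)
  have hC : 0 ≤ C := (abs_nonneg _).trans (hc 0 ω)
  unfold ratioEstimator
  split_ifs with h
  · have : 0 ≤ a * N := by positivity
    linarith [hc N ω]
  · choose k hk using hY
    have h1 : (1 : ℝ) ≤ |∑ s ∈ Finset.range N, Y s ω| := by
      simp_rw [hk] at h ⊢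
      rw [← Int.cast_sum] at h ⊢
      have : (∑ s ∈ Finset.range N, k s ω) ≠ 0 := by exact_mod_cast h
      exact_mod_cast Int.one_le_abs this
    have h2 : |∑ s ∈ Finset.range N, X s ω| ≤ a * N := by
      refine (Finset.abs_sum_le_sum_abs _ _).trans ?_
      refine (Finset.sum_le_card_nsmul _ _ a fun s _ => hX s ω).trans ?_
      simp [mul_comm]
    rw [abs_div]
    exact (div_le_self (abs_nonneg _) h1).trans (by linarith)

/-- Subtracting `θ` from the quotient puts `X - θ Y` in the numerator; the hypothesis excludes the
fallback value. -/
lemma ratioEstimator_sub_eq {X Y c : ℕ → Ω → ℝ} {θ m : ℝ} {N : ℕ} (hN : N ≠ 0) {ω : Ω}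
    (h : m + sampleMean (fun s ω => Y s ω - m) N ω ≠ 0) :
    ratioEstimator X Y c N ω - θ = sampleMean (fun s ω => X s ω - θ * Y s ω) N ω /
      (m + sampleMean (fun s ω => Y s ω - m) N ω) := by
  have hN0 : (N : ℝ) ≠ 0 := by exact_mod_cast hN
  have hden : m + sampleMean (fun s ω => Y s ω - m) N ω = (∑ s ∈ Finset.range N, Y s ω) / N := by
    simp only [sampleMean, Finset.sum_sub_distrib, Finset.sum_const, Finset.card_range,
      nsmul_eq_mul]
    field_simp
    ring
  rw [hden] at h ⊢
  have hY : ∑ s ∈ Finset.range N, Y s ω ≠ 0 := fun h0 => h (by rw [h0, zero_div])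
  rw [ratioEstimator, if_neg hY, sampleMean, Finset.sum_sub_distrib, ← Finset.mul_sum]
  field_simp

/-- The error of the ratio estimator of bounded i.i.d. pairs with integral denominators. -/
theorem isRatioError_ratioEstimator [MeasurableSpace Ω] {P : Measure Ω} [IsProbabilityMeasure P]
    {X Y c : ℕ → Ω → ℝ} {a b C θ : ℝ} (hXm : ∀ s, Measurable (X s)) (hYm : ∀ s, Measurable (Y s))
    (hX : ∀ s ω, |X s ω| ≤ a) (hY : ∀ s ω, |Y s ω| ≤ b) (hYint : ∀ s ω, ∃ k : ℤ, Y s ω = k)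
    (hindep : iIndepFun (fun s ω => (X s ω, Y s ω)) P)
    (hident : ∀ s, IdentDistrib (fun ω => (X s ω, Y s ω)) (fun ω => (X 0 ω, Y 0 ω)) P P)
    (hY0 : ∫ ω, Y 0 ω ∂P ≠ 0) (hθ : ∫ ω, X 0 ω ∂P = θ * ∫ ω, Y 0 ω ∂P)
    (hcm : ∀ N, Measurable (c N)) (hc : ∀ N ω, |c N ω| ≤ C) :
    IsRatioError P (fun s ω => X s ω - θ * Y s ω) (fun s ω => Y s ω - ∫ ω, Y 0 ω ∂P)
      (fun N ω => ratioEstimator X Y c N ω - θ) (∫ ω, Y 0 ω ∂P)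
      (a + C + |θ| + |θ| * b + b + |∫ ω, Y 0 ω ∂P|) (cov[X 0, Y 0; P] - θ * Var[Y 0; P]) := by
  set m := ∫ ω, Y 0 ω ∂P with hm
  obtain ⟨ω₀⟩ := P.nonempty_of_neZero
  have ha : 0 ≤ a := (abs_nonneg _).trans (hX 0 ω₀)
  have hb : 0 ≤ b := (abs_nonneg _).trans (hY 0 ω₀)
  have hC : 0 ≤ C := (abs_nonneg _).trans (hc 0 ω₀)
  have hXi : MemLp (X 0) 2 P := memLp_of_abs_le (hXm 0) (hX 0) 2
  have hYi : MemLp (Y 0) 2 P := memLp_of_abs_le (hYm 0) (hY 0) 2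
  have hθb : 0 ≤ |θ| * b := by positivity
  have hZid (s) : IdentDistrib (fun ω => X s ω - θ * Y s ω) (fun ω => X 0 ω - θ * Y 0 ω) P P :=
    (hident s).comp (u := fun p : ℝ × ℝ => p.1 - θ * p.2) (by fun_prop)
  have hVid (s) : IdentDistrib (fun ω => Y s ω - m) (fun ω => Y 0 ω - m) P P :=
    (hident s).comp (u := fun p : ℝ × ℝ => p.2 - m) (by fun_prop)
  have hZVid (s) : IdentDistrib (fun ω => (X s ω - θ * Y s ω) * (Y s ω - m))
      (fun ω => (X 0 ω - θ * Y 0 ω) * (Y 0 ω - m)) P P :=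
    (hident s).comp (u := fun p : ℝ × ℝ => (p.1 - θ * p.2) * (p.2 - m)) (by fun_prop)
  refine ⟨hY0, fun s => (hXm s).sub ((hYm s).const_mul θ), fun s => (hYm s).sub_const m,
    fun N => (measurable_ratioEstimator hXm hYm hcm N).sub_const θ, fun s ω => ?_, fun s ω => ?_,
    fun N hN ω => ?_, fun s => ?_, fun s => ?_, fun s => ?_,
    hindep.comp (fun _ p => p.1 - θ * p.2) fun _ => by fun_prop,
    hindep.comp (fun _ p => p.2 - m) fun _ => by fun_prop,
    fun i j hij => (hindep.indepFun hij).comp (φ := fun p : ℝ × ℝ => p.1 - θ * p.2)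
      (ψ := fun p : ℝ × ℝ => p.2 - m) (by fun_prop) (by fun_prop), hZid,
    fun N hN ω => ratioEstimator_sub_eq hN⟩
  · calc |X s ω - θ * Y s ω| ≤ |X s ω| + |θ| * |Y s ω| := by
          rw [← abs_mul]; exact abs_sub _ _
      _ ≤ a + |θ| * b := by gcongr; exacts [hX s ω, hY s ω]
      _ ≤ _ := by linarith [abs_nonneg θ, abs_nonneg m]
  · linarith [abs_sub (Y s ω) m, hY s ω, abs_nonneg θ]
  · have hN1 : (1 : ℝ) ≤ N := by exact_mod_cast Nat.one_le_iff_ne_zero.2 hN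
    calc |ratioEstimator X Y c N ω - θ| ≤ |ratioEstimator X Y c N ω| + |θ| := abs_sub _ _
      _ ≤ a * N + C * 1 + |θ| * 1 := by linarith [abs_ratioEstimator_le hX hYint hc N ω]
      _ ≤ a * N + C * N + |θ| * N := by gcongr
      _ = (a + C + |θ| + 0) * N := by ring
      _ ≤ (a + C + |θ| + (|θ| * b + b + |m|)) * N := by gcongr; positivity
      _ = _ := by ring
  · rw [(hZid s).integral_eq, integral_sub (hXi.integrable (by norm_num))
      ((hYi.integrable (by norm_num)).const_mul θ), integral_const_mul, hθ, sub_self]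
  · rw [(hVid s).integral_eq, integral_sub (hYi.integrable (by norm_num)) (integrable_const m)]
    simp [hm]
  · have hXc : MemLp (fun ω => X 0 ω - θ * m) 2 P := hXi.sub (memLp_const _)
    have hYc : MemLp (fun ω => Y 0 ω - m) 2 P := hYi.sub (memLp_const _)
    have hi1 : Integrable (fun ω => (X 0 ω - θ * m) * (Y 0 ω - m)) P := hXc.integrable_mul hYc
    have hi2 : Integrable (fun ω => (Y 0 ω - m) ^ 2) P := hYc.integrable_sq
    -- Since `E[X] = θ m`, write `X - θ Y = (X - θ m) - θ (Y - m)` and multiply by `Y - m`.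
    rw [(hZVid s).integral_eq, variance_eq_integral (hYm 0).aemeasurable, covariance, hθ, ← hm,
      ← integral_const_mul θ fun ω => (Y 0 ω - m) ^ 2, ← integral_sub hi1 (hi2.const_mul θ)]
    congr 1 with ω
    ring

end RatioEstimator

/-! ### The main theorem -/

theorem mainTheorem4
    {H : Type*} [NormedAddCommGroup H] [InnerProductSpace ℂ H] [FiniteDimensional ℂ H]
    -- the observable
    (A : H →L[ℂ] H) (hA : (A : H →ₗ[ℂ] H).IsSymmetric)
    {Ω : Type*} [MeasurableSpace Ω] (P : Measure Ω) [IsProbabilityMeasure P]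
    -- parity, acceptance indicator and measurement outcome of the trajectories
    (α D O : ℕ → Ω → ℝ)
    (hαm : ∀ s, Measurable (α s)) (hDm : ∀ s, Measurable (D s)) (hOm : ∀ s, Measurable (O s))
    (hα : ∀ s ω, α s ω = 1 ∨ α s ω = -1)
    (hD : ∀ s ω, D s ω = 0 ∨ D s ω = 1)
    (hO : ∀ s ω, O s ω ∈ Set.Icc (-‖A‖) ‖A‖)
    (hOD : ∀ s ω, D s ω = 0 → O s ω = 0)
    (X Y : ℕ → Ω → ℝ)
    (hX : ∀ s ω, X s ω = α s ω * O s ω) (hY : ∀ s ω, Y s ω = α s ω * D s ω)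
    -- the pairs are independent and identically distributed
    (hindep : iIndepFun (fun s ω => (X s ω, Y s ω)) P)
    (hident : ∀ s, IdentDistrib (fun ω => (X s ω, Y s ω)) (fun ω => (X 0 ω, Y 0 ω)) P P)
    (μX μY μ σ : ℝ)
    (hμX : μX = ∫ ω, X 0 ω ∂P) (hμY : μY = ∫ ω, Y 0 ω ∂P) (hμY0 : μY ≠ 0)
    (hμ : μ = μX / μY)
    (hσ : σ = Real.sqrt (Var[fun ω => X 0 ω - μ * Y 0 ω; P] / μY ^ 2))
    -- arbitrary uniformly bounded values of the estimator where its denominator vanishes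
    (c : ℕ → Ω → ℝ) (hcm : ∀ N, Measurable (c N)) (C : ℝ) (hc : ∀ N ω, |c N ω| ≤ C) :
    -- asymptotic normality
    TendstoInDistribution
      (fun (N : ℕ) ω => Real.sqrt N * (ratioEstimator X Y c N ω - μ)) atTop
      (id : ℝ → ℝ) (fun _ => P) (gaussianReal 0 (Real.toNNReal (σ ^ 2))) ∧
    -- the first two moments of the estimator are finite
    (∀ N : ℕ, MemLp (ratioEstimator X Y c N) 2 P) ∧
    -- asymptotics of the root-mean-square error
    ((fun N : ℕ => rmse P (ratioEstimator X Y c N) μ - σ / Real.sqrt N)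
      =o[atTop] fun N : ℕ => 1 / Real.sqrt N) ∧
    -- second-order expansion of the bias
    ((fun N : ℕ => bias P (ratioEstimator X Y c N) μ -
        1 / (N : ℝ) * ((μ * Var[Y 0; P] - cov[X 0, Y 0; P]) / μY ^ 2))
      =o[atTop] fun N : ℕ => 1 / (N : ℝ)) ∧
    -- coarse bound, to leading order, when the estimated value is at most the norm in modulus
    (|μ| ≤ ‖A‖ →
      ∃ r : ℕ → ℝ, (r =o[atTop] fun N : ℕ => 1 / Real.sqrt N) ∧
        ∀ N : ℕ, rmse P (ratioEstimator X Y c N) μ ≤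
          2 * ‖A‖ / Real.sqrt N *
            Real.sqrt ((∫ ω, D 0 ω ∂P) / (∫ ω, α 0 ω * D 0 ω ∂P) ^ 2) + r N) ∧
    -- which is so when it is a normalized expectation value of the observable
    (∀ ρ : H →ₗ[ℂ] H, ρ.IsPositive → LinearMap.trace ℂ H ρ ≠ 0 →
      (μ : ℂ) = LinearMap.trace ℂ H ((A : H →ₗ[ℂ] H) ∘ₗ ρ) / LinearMap.trace ℂ H ρ →
      |μ| ≤ ‖A‖) := by

  have hXeq : ∀ s, X s = fun ω => α s ω * O s ω := fun s => funext (hX s)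
  have hYeq : ∀ s, Y s = fun ω => α s ω * D s ω := fun s => funext (hY s)
  have hXm (s) : Measurable (X s) := by rw [hXeq]; exact (hαm s).mul (hOm s)
  have hYm (s) : Measurable (Y s) := by rw [hYeq]; exact (hαm s).mul (hDm s)
  have hα1 (s ω) : |α s ω| = 1 := by rcases hα s ω with h | h <;> simp [h]
  have hYD (s ω) : |Y s ω| = D s ω := by
    rw [hY, abs_mul, hα1, one_mul]
    rcases hD s ω with h | h <;> simp [h]
  have hXD (s ω) : |X s ω| ≤ ‖A‖ * D s ω := by
    rw [hX, abs_mul, hα1, one_mul]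
    rcases hD s ω with h | h
    · rw [hOD s ω h, h]; simp
    · rw [h, mul_one]; exact abs_le.2 (hO s ω)
  have hD1 (s ω) : D s ω ≤ 1 := by rcases hD s ω with h | h <;> simp [h]
  have hXB (s ω) : |X s ω| ≤ ‖A‖ :=
    (hXD s ω).trans (mul_le_of_le_one_right (norm_nonneg _) (hD1 s ω))
  have hYB (s ω) : |Y s ω| ≤ 1 := (hYD s ω).trans_le (hD1 s ω)
  have hYint (s ω) : ∃ k : ℤ, Y s ω = k := by
    rw [hY]
    rcases hα s ω with h | h <;> rcases hD s ω with h' | h' <;> rw [h, h']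
    exacts [⟨0, by simp⟩, ⟨1, by simp⟩, ⟨0, by simp⟩, ⟨-1, by simp⟩]
  have hm0 : ∫ ω, Y 0 ω ∂P ≠ 0 := hμY ▸ hμY0
  have hθ : ∫ ω, X 0 ω ∂P = μ * ∫ ω, Y 0 ω ∂P := by
    rw [← hμX, ← hμY, hμ, div_mul_cancel₀ _ hμY0]
  have h := isRatioError_ratioEstimator hXm hYm hXB hYB hYint hindep hident hm0 hθ hcm hc
  rw [← hμY] at h
  set v := Var[fun ω => X 0 ω - μ * Y 0 ω; P] with hv
  have hv0 : 0 ≤ v := variance_nonneg _ _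
  have hZsq : v = ∫ ω, (X 0 ω - μ * Y 0 ω) ^ 2 ∂P := by
    rw [hv, variance_eq_integral (h.measurable_num 0).aemeasurable, h.integral_num 0]
    simp
  have hσ2 : σ ^ 2 = Var[fun ω => (X 0 ω - μ * Y 0 ω) / μY; P] := by
    rw [hσ, Real.sq_sqrt (by positivity)]
    simp_rw [div_eq_inv_mul]
    rw [variance_const_mul, inv_pow]
  have hrmse : (fun N : ℕ => rmse P (ratioEstimator X Y c N) μ - σ / Real.sqrt N)
      =o[atTop] fun N : ℕ => 1 / Real.sqrt N := by
    rw [hσ]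
    refine h.isLittleO_sqrt_integral_sq fun s => ?_
    simp_rw [← pow_two]
    rw [hZsq]
    exact ((h.identDistrib_num s).comp (u := fun x => x ^ 2) (by fun_prop)).integral_eq
  have hmem (N : ℕ) : MemLp (ratioEstimator X Y c N) 2 P :=
    memLp_of_abs_le (measurable_ratioEstimator hXm hYm hcm N)
      (abs_ratioEstimator_le hXB hYint hc N) 2
  -- The remainder of the coarse bound is that of the RMSE expansion itself, so only `σ` remains to
  -- be bounded; at `N = 0` both leading terms are `0` by the convention for division.
  refine ⟨?_, hmem, hrmse, ?_, fun hle => ⟨_, hrmse, fun N => ?_⟩, fun ρ hρ hρ0 hμρ => ?_⟩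
  · rw [hσ2]
    exact h.tendstoInDistribution
  · convert h.isLittleO_integral_sub using 2 with N
    rw [bias, integral_sub ((hmem N).integrable (by norm_num)) (integrable_const μ)]
    simp
  · have hαD : ∫ ω, α 0 ω * D 0 ω ∂P = μY := by rw [hμY, hYeq 0]
    have hDi : Integrable (D 0) P :=
      Integrable.of_bound (hDm 0).aestronglyMeasurable 1
        (ae_of_all _ fun ω => by rw [← hYD, norm_abs_eq_norm]; exact hYB 0 ω)
    have hvD : v ≤ (2 * ‖A‖) ^ 2 * ∫ ω, D 0 ω ∂P := by
      rw [hZsq, ← integral_const_mul]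
      refine integral_mono_of_nonneg (ae_of_all _ fun ω => sq_nonneg _) (hDi.const_mul _)
        (ae_of_all _ fun ω => ?_)
      have hD2 : D 0 ω ^ 2 = D 0 ω := by rcases hD 0 ω with h | h <;> simp [h]
      -- Rejected samples contribute nothing to `X` or `Y`, which is why `E[D]` appears in the
      -- bound.
      have hZ : |X 0 ω - μ * Y 0 ω| ≤ 2 * ‖A‖ * D 0 ω := by
        calc |X 0 ω - μ * Y 0 ω| ≤ |X 0 ω| + |μ| * |Y 0 ω| := by rw [← abs_mul]; exact abs_sub _ _
          _ ≤ ‖A‖ * D 0 ω + ‖A‖ * |Y 0 ω| := by gcongr; exact hXD 0 ω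
          _ = _ := by rw [hYD]; ring
      calc (X 0 ω - μ * Y 0 ω) ^ 2 = |X 0 ω - μ * Y 0 ω| ^ 2 := (sq_abs _).symm
        _ ≤ (2 * ‖A‖ * D 0 ω) ^ 2 := by gcongr
        _ = (2 * ‖A‖) ^ 2 * D 0 ω := by rw [mul_pow, hD2]
    have hσle : σ ≤ 2 * ‖A‖ * Real.sqrt ((∫ ω, D 0 ω ∂P) / μY ^ 2) := by
      rw [hσ, ← Real.sqrt_sq (show (0 : ℝ) ≤ 2 * ‖A‖ by positivity),
        ← Real.sqrt_mul (sq_nonneg _), ← mul_div_assoc]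
      gcongr
    rw [hαD, div_mul_eq_mul_div]
    have : σ / Real.sqrt N ≤
        2 * ‖A‖ * Real.sqrt ((∫ ω, D 0 ω ∂P) / μY ^ 2) / Real.sqrt N := by gcongr
    linarith
  · have h1 := norm_trace_comp_le A hρ
    have h2 := congrArg norm hμρ
    rw [Complex.norm_real, Real.norm_eq_abs, norm_div] at h2
    rw [h2]
    exact div_le_of_le_mul₀ (norm_nonneg _) (norm_nonneg _) h1
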